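/- Let $\mathcal M$ be a Markov decision process with a finite state space $\mathcal S$, a finite non-empty set $\mathcal A_s$ of admissible actions for each $s\in\mathcal S$, transition probabilities $p^S(\cdot\mid s,a)$, and reward distributions $p^R(\cdot\mid s,a)$ on $\mathbb R$ with finite mean $r(s,a)$. Call a pair $(s,a)$ with $a\in\mathcal A_s$ absorbing if $p^S(s\mid s,a)=1$ and $p^R(\cdot\mid s,a)=\delta_0$. Assume that $\mathcal M$ has a unique absorbing pair $(s^g,a^g)$, and that $\mathcal A_{s^g}=\{a^g\}$. A policy $\pi$ assigns to each state $s$ a probability distribution $\pi(\cdot\mid s)$ on $\mathcal A_s$; it is deterministic if each $\pi(\cdot\mid s)$ is a point mass, and $\Pi$ is the set of all policies. Under $\pi$, the process evolves by $A_t\sim\pi(\cdot\mid S_t)$, $R_t\sim p^R(\cdot\mid S_t,A_t)$, $S_{t+1}\sim p^S(\cdot\mid S_t,A_t)$. A policy is proper if $\lim_{t\to\infty}\mathbb P^\pi(S_t\ne s^g\mid S_0=s)=0$ for every $s\in\mathcal S$, and improper otherwise. For $\pi\in\Pi$ put, in $[-\infty,\infty]$, $$V^\pi(s)=\lim_{\tau\to\infty}\mathbb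 E^\pi\Big[\sum_{t=0}^{\tau}R_t\,\Big|\,S_0=s\Big],\qquad Q^\pi(s,a)=\lim_{\tau\to\infty}\mathbb E^\pi\Big[\sum_{t=0}^{\tau}R_t\,\Big|\,S_0=s,\,A_0=a\Big],$$ where the lower limit is taken if the limit does not exist, and $$Q^*(s,a)=\sup_{\pi\in\Pi}Q^\pi(s,a).$$ Assume that a proper policy exists, and that for every improper deterministic policy $\pi$ there is a state $s$ with $V^\pi(s)=-\infty$. Then $Q^*(s,a)$ is finite for all $s\in\mathcal S$, $a\in\mathcal A_s$, it satisfies $Q^*(s^g,a^g)=0$ and the Bellman optimality equations $$Q^*(s,a)=r(s,a)+\sum_{s'\in\mathcal S}p^S(s'\mid s,a)\max_{a'\in\mathcal A_{s'}}Q^*(s',a')\qquad\text{for all }s\in\mathcal S,\ a\in\mathcal A_s,$$ and it is their only solution among the real-valued functions $Q$ on $\{(s,a): s\in\mathcal S,\ a\in\mathcal A_s\}$ with $Q(s^g,a^g)=0$. -/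

import Mathlib

open Filter Topology MeasureTheory
open scoped ENNReal

/-- A Markov decision process with state space `S`, admissible actions `A s` at the state `s`,
transition probabilities `p^S(· | s, a)` and reward distributions `p^R(· | s, a)` on `ℝ` with finite
mean. Finiteness of `S` and of every `A s` is imposed where the structure is used. -/
structure MDP (S : Type*) (A : S → Type*) where
  /-- the law of the next state -/
  trans : (s : S) → A s → PMF S
  /-- the law of the reward -/
  reward : (s : S) → A s → Measure ℝ
  reward_prob : ∀ s a, IsProbabilityMeasure (reward s a)
  reward_mean : ∀ s a, Integrable (fun x : ℝ => x) (reward s a)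

/-- A stationary (possibly randomised) policy: a probability distribution on the admissible actions
of every state. -/
abbrev Policy {S : Type*} (A : S → Type*) := (s : S) → PMF (A s)

/-- The deterministic policy that plays the action `f s` in the state `s`. -/
noncomputable def Policy.det {S : Type*} {A : S → Type*} (f : (s : S) → A s) : Policy A :=
  fun s => PMF.pure (f s)

namespace MDP

section

variable {S : Type*} {A : S → Type*} (M : MDP S A)

/-- The law of `(S_t, A_t)` under the policy `π`, when `(S_0, A_0)` has the law `ν`: given
`(S_t, A_t) = (s, a)`, the next state is drawn from `p^S(· | s, a)`, and the next action from
`π(· | S_{t+1})`. -/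
noncomputable def law (π : Policy A) (ν : PMF (Σ s, A s)) : ℕ → PMF (Σ s, A s)
  | 0 => ν
  | t + 1 => (law π ν t).bind fun x =>
      (M.trans x.1 x.2).bind fun s' => (π s').map (Sigma.mk s')

/-- The law of `(S_0, A_0)` under the policy `π` given `S_0 = s`. -/
noncomputable def startState (π : Policy A) (s : S) : PMF (Σ s, A s) :=
  (π s).map (Sigma.mk s)

/-- The law of `(S_0, A_0)` given `S_0 = s` and `A_0 = a`. -/
noncomputable def startPair (s : S) (a : A s) : PMF (Σ s, A s) :=
  PMF.pure ⟨s, a⟩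

/-- The pair `(s, a)` is absorbing: it leads back to `s` with probability one, and its reward is
zero with probability one. -/
def IsAbsorbing (s : S) (a : A s) : Prop :=
  M.trans s a = PMF.pure s ∧ M.reward s a = Measure.dirac 0

/-- `(sg, ag)` is the unique absorbing state-action pair of the process, and `ag` is the only
action at the goal state `sg`. -/
structure IsGoal (sg : S) (ag : A sg) : Prop where
  absorbing : M.IsAbsorbing sg ag
  only_action : ∀ a : A sg, a = ag
  unique : ∀ (s : S) (a : A s), M.IsAbsorbing s a → s = sg

/-- The policy `π` is proper: from every initial state `s`, `P^π(S_t ≠ sg | S_0 = s) → 0`. -/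
def IsProper (sg : S) (π : Policy A) : Prop :=
  ∀ s : S, Tendsto
    (fun t => (M.law π (startState π s) t).toOuterMeasure {x | x.1 ≠ sg}) atTop (𝓝 0)

end

section

variable {S : Type*} {A : S → Type*} [Fintype S] [∀ s, Fintype (A s)] (M : MDP S A)

/-- The law of the reward `R_t`: the mixture of the laws `p^R(· | s, a)` under the law of
`(S_t, A_t)`. -/
noncomputable def rewardLaw (π : Policy A) (ν : PMF (Σ s, A s)) (t : ℕ) : Measure ℝ :=
  ∑ x : Σ s, A s, M.law π ν t x • M.reward x.1 x.2

/-- The expected total reward `E^π[∑_{t=0}^τ R_t]` up to time `τ`. -/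
noncomputable def partialReturn (π : Policy A) (ν : PMF (Σ s, A s)) (τ : ℕ) : ℝ :=
  ∑ t ∈ Finset.range (τ + 1), ∫ r, r ∂(M.rewardLaw π ν t)

/-- The expected total reward `lim_{τ → ∞} E^π[∑_{t=0}^τ R_t]`, in the extended reals. The limit
inferior makes it defined for every policy; it is the limit wherever that exists. -/
noncomputable def totalReturn (π : Policy A) (ν : PMF (Σ s, A s)) : EReal :=
  liminf (fun τ => (M.partialReturn π ν τ : EReal)) atTop

/-- The state value `V^π(s)`. -/
noncomputable def V (π : Policy A) (s : S) : EReal :=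
  M.totalReturn π (startState π s)

/-- The action value `Q^π(s, a)`. -/
noncomputable def Q (π : Policy A) (s : S) (a : A s) : EReal :=
  M.totalReturn π (startPair s a)

/-- The optimal action value `Q*(s, a) = sup_π Q^π(s, a)`. -/
noncomputable def Qstar (s : S) (a : A s) : EReal :=
  ⨆ π : Policy A, M.Q π s a

/-- The standing assumption: a proper policy exists, and every deterministic policy that is not
proper has infinite cost, that is, value `-∞`, from at least one initial state. -/
structure ProperAssumption (sg : S) : Prop where
  exists_proper : ∃ π : Policy A, M.IsProper sg π
  improper_cost : ∀ f : (s : S) → A s,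
    ¬ M.IsProper sg (Policy.det f) → ∃ s, M.V (Policy.det f) s = ⊥

/-- The Bellman optimality equations for `q`:
`q(s, a) = E[R(s, a)] + ∑_{s'} p^S(s' | s, a) max_{a'} q(s', a')` for all `s` and `a`. -/
def BellmanOptimality [∀ s, Nonempty (A s)] (q : (s : S) → A s → ℝ) : Prop :=
  ∀ (s : S) (a : A s), q s a = ∫ r, r ∂(M.reward s a) +
    ∑ s' : S, (M.trans s a s').toReal * Finset.univ.sup' Finset.univ_nonempty (q s')

end

end MDP

/-! A policy π induces a Markov operator P on functions of state-action pairs, and its partial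
returns are the sums of P^t r. If u ≤ r + P u, these sums are at least u - P^n u, hence bounded
below; so a deterministic policy admitting such a u must be proper (`ImproperCost.isAbsorbedAt`).

Existence is policy improvement (`exists_bellman`): the policy greedy for the value of any proper
policy is proper and no worse, so a best deterministic proper policy has a value solving the Bellman
equation.

Any solution q equals Q* (`qstar_eq_of_bellman`), which also gives uniqueness. The greedy policy for
q attains q. For the upper bound, a start from which π is absorbed lets P^n q vanish. Otherwise the
reward is raised by a small ε off the goal: the hypotheses survive (`exists_perturbation`), so the
raised problem has a Bellman solution w, which bounds the raised sums above. The time spent off the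
goal grows linearly, so the original sums tend to -∞. -/

/-! ### Markov operators and absorbed chains -/

section MarkovOperator

variable {X : Type*}

/-- A Markov operator on the real functions on `X`: linear, monotone and preserving `1`. -/
structure IsMarkov (P : Module.End ℝ (X → ℝ)) : Prop where
  mono : Monotone P
  map_one : P 1 = 1

/-- The indicator function of the complement of `{g}`. -/
noncomputable def offPoint (g : X) : X → ℝ := Set.indicator {g}ᶜ 1

@[simp] lemma offPoint_self (g : X) : offPoint g g = 0 := by simp [offPoint]

lemma offPoint_of_ne {g x : X} (h : x ≠ g) : offPoint g x = 1 := by simp [offPoint, h]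

lemma offPoint_nonneg (g : X) : 0 ≤ offPoint g := fun x => by
  by_cases h : x = g
  · simp [h]
  · simp [offPoint_of_ne h]

lemma offPoint_le_one (g : X) : offPoint g ≤ 1 := fun x => by
  by_cases h : x = g
  · simp [h]
  · simp [offPoint_of_ne h]

/-- The sum of the first `n` expected rewards of a chain with transition operator `P`. -/
noncomputable def partialSum (P : Module.End ℝ (X → ℝ)) (r : X → ℝ) (n : ℕ) : X → ℝ :=
  ∑ t ∈ Finset.range n, (P ^ t) r

/-- The chain with transition operator `P` leaves the complement of `g` almost surely. -/
def IsAbsorbedAt (P : Module.End ℝ (X → ℝ)) (g : X) : Prop :=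
  ∀ x, Tendsto (fun t => (P ^ t) (offPoint g) x) atTop (𝓝 0)

lemma partialSum_succ (P : Module.End ℝ (X → ℝ)) (r : X → ℝ) (n : ℕ) :
    partialSum P r (n + 1) = partialSum P r n + (P ^ n) r := Finset.sum_range_succ _ _

lemma partialSum_add (P : Module.End ℝ (X → ℝ)) (r r' : X → ℝ) (n : ℕ) :
    partialSum P (r + r') n = partialSum P r n + partialSum P r' n := by
  simp [partialSum, Finset.sum_add_distrib]

lemma partialSum_smul (P : Module.End ℝ (X → ℝ)) (c : ℝ) (r : X → ℝ) (n : ℕ) :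
    partialSum P (c • r) n = c • partialSum P r n := by
  simp [partialSum, Finset.smul_sum]

lemma pow_apply_of_fixed {P : Module.End ℝ (X → ℝ)} {f : X → ℝ} (h : P f = f) (n : ℕ) :
    (P ^ n) f = f := by
  rw [Module.End.pow_apply]; exact Function.iterate_fixed h n

lemma partialSum_sub_apply (P : Module.End ℝ (X → ℝ)) (h : X → ℝ) (n : ℕ) :
    partialSum P (h - P h) n = h - (P ^ n) h := by
  induction n with
  | zero => simp [partialSum]
  | succ n ih => rw [partialSum_succ, ih, map_sub, pow_succ, Module.End.mul_apply]; abel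

lemma partialSum_of_fixed {P : Module.End ℝ (X → ℝ)} {f : X → ℝ} (h : P f = f) (n : ℕ) :
    partialSum P f n = n • f := by
  simp [partialSum, pow_apply_of_fixed h]

namespace IsMarkov

variable {P : Module.End ℝ (X → ℝ)}

lemma pow (hP : IsMarkov P) (n : ℕ) : IsMarkov (P ^ n) := by
  refine ⟨?_, pow_apply_of_fixed hP.map_one n⟩
  induction n with
  | zero => exact fun _ _ h => h
  | succ n ih => rw [pow_succ]; exact fun _ _ h => ih (hP.mono h)

lemma map_nonneg (hP : IsMarkov P) {f : X → ℝ} (hf : 0 ≤ f) : 0 ≤ P f := by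
  simpa using hP.mono hf

lemma abs_apply_le_mul (hP : IsMarkov P) {f u : X → ℝ} {c : ℝ} (h : ∀ x, |f x| ≤ c * u x)
    (x : X) : |P f x| ≤ c * P u x := by
  have h₁ := hP.mono (show f ≤ c • u from fun y => (abs_le.1 (h y)).2) x
  have h₂ := hP.mono (show -(c • u) ≤ f from fun y => (abs_le.1 (h y)).1) x
  simp only [map_neg, map_smul, Pi.neg_apply, Pi.smul_apply, smul_eq_mul] at h₁ h₂
  exact abs_le.2 ⟨h₂, h₁⟩

lemma abs_apply_le [Fintype X] (hP : IsMarkov P) (f : X → ℝ) (x : X) : |P f x| ≤ ‖f‖ := by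
  have := hP.abs_apply_le_mul (f := f) (u := 1) (c := ‖f‖)
    (fun y => by simpa using norm_le_pi_norm f y) x
  simpa [hP.map_one] using this

/-- Iterate the inequality: monotonicity of P^n carries it into the remainder term. -/
lemma le_partialSum_add (hP : IsMarkov P) {r u : X → ℝ} (h : u ≤ r + P u) (n : ℕ) :
    u ≤ partialSum P r n + (P ^ n) u := by
  induction n with
  | zero => simp [partialSum]
  | succ n ih =>
    refine ih.trans ?_
    rw [partialSum_succ, pow_succ, Module.End.mul_apply, add_assoc, ← map_add]
    exact add_le_add_right ((hP.pow n).mono h) _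

lemma partialSum_add_le (hP : IsMarkov P) {r u : X → ℝ} (h : r + P u ≤ u) (n : ℕ) :
    partialSum P r n + (P ^ n) u ≤ u := by
  have := hP.le_partialSum_add (r := -r) (u := -u)
    (by simpa [add_comm] using neg_le_neg h) n
  have h₂ : partialSum P (-r) n = -partialSum P r n := by simp [partialSum]
  rw [h₂, map_neg] at this
  simpa [add_comm] using neg_le_neg this

lemma neg_norm_le_partialSum [Fintype X] (hP : IsMarkov P) {r u : X → ℝ} (h : u ≤ r + P u)
    (n : ℕ) (x : X) : -(2 * ‖u‖) ≤ partialSum P r n x := by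
  have h₁ := hP.le_partialSum_add h n x
  have h₂ := abs_le.1 ((hP.pow n).abs_apply_le u x)
  have h₃ : |u x| ≤ ‖u‖ := norm_le_pi_norm u x
  rw [Pi.add_apply] at h₁
  linarith [abs_le.1 h₃]

lemma partialSum_le_norm [Fintype X] (hP : IsMarkov P) {r u : X → ℝ} (h : r + P u ≤ u)
    (n : ℕ) (x : X) : partialSum P r n x ≤ 2 * ‖u‖ := by
  have h₁ := hP.partialSum_add_le h n x
  have h₂ := abs_le.1 ((hP.pow n).abs_apply_le u x)
  have h₃ : |u x| ≤ ‖u‖ := norm_le_pi_norm u x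
  rw [Pi.add_apply] at h₁
  linarith [abs_le.1 h₃]

/-- Every function is the sum of a coboundary and an invariant function. -/
lemma exists_decomposition [Fintype X] (hP : IsMarkov P) (r : X → ℝ) :
    ∃ h c : X → ℝ, r = (h - P h) + c ∧ P c = c := by
  let L : Module.End ℝ (X → ℝ) := 1 - P
  have hL : ∀ f, L f = f - P f := fun f => rfl
  -- If f = h - P h is invariant, then n f = h - P^n h stays bounded in n, so f = 0.
  have hdisj : Disjoint (LinearMap.range L) (LinearMap.ker L) := by
    rw [Submodule.disjoint_def]
    rintro f ⟨h, rfl⟩ hf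
    rw [LinearMap.mem_ker, hL (L h), sub_eq_zero] at hf
    ext x
    by_contra hx
    have hb : ∀ n : ℕ, n * |L h x| ≤ 2 * ‖h‖ := fun n => by
      have h₁ := congrFun (partialSum_of_fixed hf.symm n) x
      rw [hL, partialSum_sub_apply] at h₁
      have h₂ := abs_le.1 ((hP.pow n).abs_apply_le h x)
      have h₃ := abs_le.1 (show |h x| ≤ ‖h‖ from norm_le_pi_norm h x)
      have h₄ : (n : ℝ) * L h x = h x - (P ^ n) h x := by simpa [hL] using h₁.symm
      rw [← Nat.abs_cast n, ← abs_mul, h₄, abs_le]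
      constructor <;> linarith
    obtain ⟨n, hn⟩ := exists_nat_gt (2 * ‖h‖ / |L h x|)
    rw [div_lt_iff₀ (abs_pos.2 hx)] at hn
    exact absurd (hb n) (not_le.2 hn)
  have htop : LinearMap.range L ⊔ LinearMap.ker L = ⊤ :=
    Submodule.eq_top_of_disjoint _ _ (LinearMap.finrank_range_add_finrank_ker L).ge hdisj
  obtain ⟨_, ⟨h, rfl⟩, c, hc, hr⟩ := Submodule.mem_sup.1 (htop ▸ Submodule.mem_top (x := r))
  refine ⟨h, c, hr.symm, ?_⟩
  rw [LinearMap.mem_ker, hL, sub_eq_zero] at hc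
  exact hc.symm

/-- Unboundedness below of the partial sums is stable under small increases of the reward. -/
lemma exists_perturbation [Fintype X] (hP : IsMarkov P) {r u : X → ℝ} (hu : u ≤ 1)
    (hr : ∀ b : ℝ, ∃ n x, partialSum P r n x < b) :
    ∃ ε : ℝ, 0 < ε ∧ ∀ δ : ℝ, 0 ≤ δ → δ ≤ ε → ∀ b : ℝ, ∃ n x, partialSum P (r + δ • u) n x < b := by
  obtain ⟨h, c, rfl, hc⟩ := hP.exists_decomposition r
  have hsum : ∀ n x, partialSum P ((h - P h) + c) n x = h x - (P ^ n) h x + n * c x :=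
    fun n x => by simp [partialSum_add, partialSum_sub_apply, partialSum_of_fixed hc]
  have hh : ∀ n x, |h x - (P ^ n) h x| ≤ 2 * ‖h‖ := fun n x => by
    have h₂ := abs_le.1 ((hP.pow n).abs_apply_le h x)
    have h₃ := abs_le.1 (show |h x| ≤ ‖h‖ from norm_le_pi_norm h x)
    rw [abs_le]
    constructor <;> linarith
  obtain ⟨x, hx⟩ : ∃ x, c x < 0 := by
    by_contra! hc0
    obtain ⟨n, x, hn⟩ := hr (-(2 * ‖h‖))
    rw [hsum] at hn
    have := mul_nonneg (Nat.cast_nonneg (α := ℝ) n) (hc0 x)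
    linarith [abs_le.1 (hh n x)]
  -- The invariant part c makes the sums drift by c x < 0 per step; an increase of at most -c x / 2
  -- leaves at least half of that drift.
  refine ⟨-c x / 2, by linarith, fun δ hδ0 hδ b => ?_⟩
  obtain ⟨n, hn⟩ := exists_nat_gt ((2 * ‖h‖ - b) / (-c x / 2))
  rw [div_lt_iff₀ (by linarith)] at hn
  refine ⟨n, x, ?_⟩
  have h1 : P 1 = 1 := hP.map_one
  have hu' : partialSum P u n x ≤ n := by
    have : partialSum P u n ≤ partialSum P 1 n :=
      Finset.sum_le_sum fun t _ => (hP.pow t).mono hu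
    simpa [partialSum_of_fixed h1] using this x
  rw [partialSum_add, partialSum_smul, Pi.add_apply, hsum, Pi.smul_apply, smul_eq_mul]
  have h₁ := mul_le_mul_of_nonneg_left hu' hδ0
  have h₂ := mul_le_mul_of_nonneg_right hδ (Nat.cast_nonneg (α := ℝ) n)
  nlinarith [abs_le.1 (hh n x)]

variable {g : X}

lemma map_offPoint_le (hP : IsMarkov P) (hg : ∀ f, P f g = f g) :
    P (offPoint g) ≤ offPoint g := fun x => by
  by_cases h : x = g
  · rw [h, hg]
  · rw [offPoint_of_ne h]
    simpa [hP.map_one] using hP.mono (offPoint_le_one g) x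

lemma antitone_pow_offPoint (hP : IsMarkov P) (hg : ∀ f, P f g = f g) (x : X) :
    Antitone fun t => (P ^ t) (offPoint g) x := by
  refine antitone_nat_of_succ_le fun t => ?_
  rw [pow_succ, Module.End.mul_apply]
  exact (hP.pow t).mono (hP.map_offPoint_le hg) x

/-- Since f vanishes at g, |f| ≤ ‖f‖ • `offPoint g`. -/
lemma tendsto_pow_apply [Fintype X] (hP : IsMarkov P) {f : X → ℝ} (hf : f g = 0) {x : X}
    (hx : Tendsto (fun t => (P ^ t) (offPoint g) x) atTop (𝓝 0)) :
    Tendsto (fun t => (P ^ t) f x) atTop (𝓝 0) := by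
  refine squeeze_zero_norm (fun t => ?_) (by simpa using hx.const_mul ‖f‖)
  refine (hP.pow t).abs_apply_le_mul (fun y => ?_) x
  by_cases h : y = g
  · simp [h, hf]
  · simpa [offPoint_of_ne h] using norm_le_pi_norm f y

/-- The Poisson equation of an absorbed chain is solvable. -/
lemma exists_poisson [Fintype X] (hP : IsMarkov P) (hg : ∀ f, P f g = f g)
    (habs : IsAbsorbedAt P g) {r : X → ℝ} (hr : r g = 0) :
    ∃ v : X → ℝ, v g = 0 ∧ v = r + P v := by
  classical
  -- Every f - P f vanishes at g; adding the value f g there makes the operator injective, hence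
  -- surjective.
  let L : Module.End ℝ (X → ℝ) :=
    1 - P + (LinearMap.single ℝ (fun _ : X => ℝ) g) ∘ₗ (LinearMap.proj g)
  have hL : ∀ f, L f = f - P f + Pi.single g (f g) := fun f => rfl
  have hLg : ∀ f, L f g = f g := fun f => by simp [hL, hg]
  have hinj : Function.Injective L := by
    rw [← LinearMap.ker_eq_bot, LinearMap.ker_eq_bot']
    intro f hf
    have hfg : f g = 0 := by rw [← hLg f, hf]; rfl
    have hfix : P f = f := by
      rw [hL, hfg, Pi.single_zero, add_zero, sub_eq_zero] at hf
      exact hf.symm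
    ext x
    have := hP.tendsto_pow_apply hfg (habs x)
    simp only [pow_apply_of_fixed hfix] at this
    exact tendsto_nhds_unique tendsto_const_nhds this
  obtain ⟨v, hv⟩ := (LinearMap.injective_iff_surjective.1 hinj) r
  have hvg : v g = 0 := by rw [← hLg v, hv, hr]
  refine ⟨v, hvg, ?_⟩
  rw [hL, hvg, Pi.single_zero, add_zero] at hv
  rw [← hv]; abel

/-- A subsolution of the Poisson equation of an absorbed chain is below the solution. -/
lemma le_of_le_add [Fintype X] (hP : IsMarkov P) (habs : IsAbsorbedAt P g)
    {r u v : X → ℝ} (hug : u g = 0) (hvg : v g = 0) (hu : u ≤ r + P u) (hv : v = r + P v) :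
    u ≤ v := fun x => by
  have h : ∀ n, u x - v x ≤ (P ^ n) (u - v) x := fun n => by
    have h₁ := hP.le_partialSum_add hu n x
    have h₂ := hP.partialSum_add_le hv.ge n x
    simp only [Pi.add_apply, map_sub, Pi.sub_apply] at *
    linarith
  have := ge_of_tendsto' (hP.tendsto_pow_apply (f := u - v) (by simp [hug, hvg]) (habs x)) h
  linarith

end IsMarkov
end MarkovOperator

/-! ### Expectations over finite types -/

namespace PMF

/-- The expectation of a real function under a distribution on a finite type. -/
noncomputable def expect {α : Type*} [Fintype α] (p : PMF α) (f : α → ℝ) : ℝ :=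
  ∑ a, (p a).toReal * f a

variable {α β : Type*} [Fintype α] [Fintype β]

lemma sum_toReal (p : PMF α) : ∑ a, (p a).toReal = 1 := by
  rw [← ENNReal.toReal_sum fun a _ => p.apply_ne_top a, ← tsum_fintype (L := .unconditional α), p.tsum_coe]
  rfl

lemma expect_const (p : PMF α) (c : ℝ) : p.expect (fun _ => c) = c := by
  rw [expect, ← Finset.sum_mul, p.sum_toReal, one_mul]

lemma expect_mono (p : PMF α) {f f' : α → ℝ} (h : ∀ a, f a ≤ f' a) : p.expect f ≤ p.expect f' :=
  Finset.sum_le_sum fun a _ => mul_le_mul_of_nonneg_left (h a) ENNReal.toReal_nonneg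

lemma expect_le (p : PMF α) {f : α → ℝ} {c : ℝ} (h : ∀ a, f a ≤ c) : p.expect f ≤ c :=
  (p.expect_mono h).trans_eq (p.expect_const c)

lemma expect_pure (a : α) (f : α → ℝ) : (pure a).expect f = f a := by
  classical
  rw [expect, Finset.sum_eq_single a]
  · simp
  · intro b _ hb; simp [hb]
  · simp

lemma expect_bind (p : PMF α) (k : α → PMF β) (f : β → ℝ) :
    (p.bind k).expect f = p.expect fun a => (k a).expect f := by
  simp only [expect, bind_apply, tsum_fintype, Finset.mul_sum]
  rw [Finset.sum_comm]
  refine Finset.sum_congr rfl fun b _ => ?_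
  rw [ENNReal.toReal_sum fun a _ => ENNReal.mul_ne_top (p.apply_ne_top a) ((k a).apply_ne_top b),
    Finset.sum_mul]
  exact Finset.sum_congr rfl fun a _ => by rw [ENNReal.toReal_mul, mul_assoc]

lemma expect_map (p : PMF α) (k : α → β) (f : β → ℝ) :
    (p.map k).expect f = p.expect (f ∘ k) := by
  rw [← bind_pure_comp, expect_bind]
  simp [expect_pure, Function.comp_def]

lemma expect_add (p : PMF α) (f f' : α → ℝ) : p.expect (f + f') = p.expect f + p.expect f' := by
  simp [expect, mul_add, Finset.sum_add_distrib]

lemma expect_smul (p : PMF α) (c : ℝ) (f : α → ℝ) : p.expect (c • f) = c * p.expect f := by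
  simp only [expect, Finset.mul_sum, Pi.smul_apply, smul_eq_mul]
  exact Finset.sum_congr rfl fun _ _ => by ring

end PMF

/-! ### The chain of state-action pairs -/

namespace MDP

variable {S : Type*} {A : S → Type*} [Fintype S] [∀ s, Fintype (A s)] (M : MDP S A)

/-- The mean reward of a state-action pair. -/
noncomputable def meanReward (x : Σ s, A s) : ℝ := ∫ r, r ∂(M.reward x.1 x.2)

/-- The transition operator of the chain of state-action pairs under a policy. -/
noncomputable def transOp (π : Policy A) : Module.End ℝ ((Σ s, A s) → ℝ) where
  toFun q x := (M.trans x.1 x.2).expect fun s' => (π s').expect fun a' => q ⟨s', a'⟩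
  map_add' q q' := by
    ext x
    rw [Pi.add_apply, ← PMF.expect_add]
    congr 1; ext s'
    exact PMF.expect_add _ _ _
  map_smul' c q := by
    ext x
    rw [Pi.smul_apply, RingHom.id_apply, smul_eq_mul, ← PMF.expect_smul]
    congr 1; ext s'
    exact PMF.expect_smul _ _ _

lemma transOp_apply (π : Policy A) (q : (Σ s, A s) → ℝ) (x : Σ s, A s) :
    M.transOp π q x =
      (M.trans x.1 x.2).expect fun s' => (π s').expect fun a' => q ⟨s', a'⟩ := rfl

lemma transOp_det_apply (f : (s : S) → A s) (q : (Σ s, A s) → ℝ) (x : Σ s, A s) :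
    M.transOp (Policy.det f) q x = (M.trans x.1 x.2).expect fun s' => q ⟨s', f s'⟩ := by
  simp [transOp_apply, Policy.det, PMF.expect_pure]

lemma isMarkov_transOp (π : Policy A) : IsMarkov (M.transOp π) where
  mono _ _ h x := PMF.expect_mono _ fun s' => PMF.expect_mono _ fun a' => h ⟨s', a'⟩
  map_one := by ext x; simp [transOp_apply, PMF.expect_const]

section Law

/-- Duality: evolving the law forward amounts to applying the operator to the function. -/
lemma expect_law (π : Policy A) (ν : PMF (Σ s, A s)) (t : ℕ) (q : (Σ s, A s) → ℝ) :
    (M.law π ν t).expect q = ν.expect ((M.transOp π ^ t) q) := by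
  induction t generalizing q with
  | zero => rfl
  | succ t ih =>
    have h : (M.law π ν (t + 1)).expect q = (M.law π ν t).expect (M.transOp π q) := by
      rw [law, PMF.expect_bind]
      congr 1; ext x
      simp only [PMF.expect_bind, PMF.expect_map]
      rfl
    rw [h, ih, pow_succ, Module.End.mul_apply]

lemma integral_rewardLaw (π : Policy A) (ν : PMF (Σ s, A s)) (t : ℕ) :
    ∫ r, r ∂(M.rewardLaw π ν t) = (M.law π ν t).expect M.meanReward := by
  rw [rewardLaw, integral_finsetSum_measure fun x _ =>
    (M.reward_mean x.1 x.2).smul_measure (PMF.apply_ne_top _ x)]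
  simp only [integral_smul_measure, smul_eq_mul]
  rfl

lemma partialReturn_eq (π : Policy A) (ν : PMF (Σ s, A s)) (τ : ℕ) :
    M.partialReturn π ν τ = ν.expect (partialSum (M.transOp π) M.meanReward (τ + 1)) := by
  simp only [partialReturn, integral_rewardLaw, expect_law]
  rw [partialSum]
  simp only [PMF.expect, Finset.sum_apply, Finset.mul_sum]
  exact Finset.sum_comm

lemma partialReturn_startPair (π : Policy A) (s : S) (a : A s) (τ : ℕ) :
    M.partialReturn π (startPair s a) τ =
      partialSum (M.transOp π) M.meanReward (τ + 1) ⟨s, a⟩ := by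
  rw [partialReturn_eq, startPair, PMF.expect_pure]

lemma toReal_toOuterMeasure_law (π : Policy A) (ν : PMF (Σ s, A s)) (t : ℕ) {sg : S} {ag : A sg}
    (hsg : ∀ a : A sg, a = ag) :
    ((M.law π ν t).toOuterMeasure {x | x.1 ≠ sg}).toReal =
      ν.expect ((M.transOp π ^ t) (offPoint ⟨sg, ag⟩)) := by
  rw [← expect_law, PMF.toOuterMeasure_apply_fintype, ENNReal.toReal_sum]
  · refine Finset.sum_congr rfl fun x _ => ?_
    by_cases h : x.1 = sg
    · have hx : x = ⟨sg, ag⟩ := by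
        obtain ⟨s, a⟩ := x
        obtain rfl : s = sg := h
        rw [hsg a]
      simp [hx]
    · have hx : x ≠ ⟨sg, ag⟩ := fun hx => h (by rw [hx])
      simp [offPoint_of_ne hx, h]
  · intro x _
    refine ne_top_of_le_ne_top (PMF.apply_ne_top (M.law π ν t) x) ?_
    exact Set.indicator_le_self _ _ x

lemma toOuterMeasure_ne_top {α : Type*} (p : PMF α) (s : Set α) : p.toOuterMeasure s ≠ ⊤ := by
  refine ne_top_of_le_ne_top ENNReal.one_ne_top ?_
  rw [← p.tsum_coe, PMF.toOuterMeasure_apply]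
  exact ENNReal.tsum_le_tsum fun x => Set.indicator_le_self _ _ x

/-- A policy is proper if and only if its chain of state-action pairs is absorbed at the goal. -/
lemma isProper_iff (π : Policy A) {sg : S} {ag : A sg} (hsg : ∀ a : A sg, a = ag) :
    M.IsProper sg π ↔ IsAbsorbedAt (M.transOp π) ⟨sg, ag⟩ := by
  have hkey : M.IsProper sg π ↔ ∀ s, Tendsto
      (fun t => (π s).expect fun a => (M.transOp π ^ t) (offPoint ⟨sg, ag⟩) ⟨s, a⟩)
      atTop (𝓝 0) := by
    refine forall_congr' fun s => ?_
    rw [← ENNReal.tendsto_toReal_iff (fun t => toOuterMeasure_ne_top _ _) ENNReal.zero_ne_top]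
    simp only [M.toReal_toOuterMeasure_law π _ _ hsg, startState, PMF.expect_map]
    rfl
  rw [hkey]
  constructor
  · intro h x
    -- After one step from a pair, the chain restarts from a state with its action drawn from π,
    -- where `h` applies.
    rw [← tendsto_add_atTop_iff_nat 1]
    simp only [pow_succ', Module.End.mul_apply, transOp_apply]
    have := tendsto_finsetSum Finset.univ
      fun s' _ => (h s').const_mul (M.trans x.1 x.2 s').toReal
    simp only [mul_zero, Finset.sum_const_zero] at this
    exact this
  · intro h s
    have := tendsto_finsetSum Finset.univ fun a _ => (h ⟨s, a⟩).const_mul (π s a).toReal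
    simp only [mul_zero, Finset.sum_const_zero] at this
    exact this

end Law

/-! ### Bellman equation and optimal values -/

section Optimality

/-- Every deterministic policy that is not absorbed at `g` has partial sums of the reward `r` that
are unbounded below. -/
def ImproperCost (g : Σ s, A s) (r : (Σ s, A s) → ℝ) : Prop :=
  ∀ f : (s : S) → A s, ¬ IsAbsorbedAt (M.transOp (Policy.det f)) g →
    ∀ b : ℝ, ∃ n x, partialSum (M.transOp (Policy.det f)) r n x < b

variable {M} {g : Σ s, A s} {r : (Σ s, A s) → ℝ}

lemma ImproperCost.isAbsorbedAt (h : M.ImproperCost g r) {f : (s : S) → A s}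
    {u : (Σ s, A s) → ℝ} (hu : u ≤ r + M.transOp (Policy.det f) u) :
    IsAbsorbedAt (M.transOp (Policy.det f)) g := by
  by_contra hf
  obtain ⟨n, x, hn⟩ := h f hf (-(2 * ‖u‖))
  exact absurd ((M.isMarkov_transOp _).neg_norm_le_partialSum hu n x) (not_le.2 hn)

lemma ProperAssumption.improperCost {sg : S} {ag : A sg} (hM : M.ProperAssumption sg)
    (hsg : ∀ a : A sg, a = ag) : M.ImproperCost ⟨sg, ag⟩ M.meanReward := by
  intro f hf b
  rw [← M.isProper_iff _ hsg] at hf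
  obtain ⟨s, hs⟩ := hM.improper_cost f hf
  by_contra! hb
  refine absurd hs (ne_of_gt (lt_of_lt_of_le (EReal.bot_lt_coe b) ?_))
  refine le_liminf_of_le (by isBoundedDefault) (Eventually.of_forall fun τ => ?_)
  rw [EReal.coe_le_coe_iff, partialReturn_eq, startState, Policy.det, PMF.pure_map,
    PMF.expect_pure]
  exact hb _ _

variable (M) [∀ s, Nonempty (A s)]

/-- The expectation of the maximum of `q` over the actions in the next state. -/
noncomputable def maxOp (q : (Σ s, A s) → ℝ) (x : Σ s, A s) : ℝ :=
  (M.trans x.1 x.2).expect fun s' =>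
    Finset.univ.sup' Finset.univ_nonempty fun a' => q ⟨s', a'⟩

lemma transOp_le_maxOp (π : Policy A) (q : (Σ s, A s) → ℝ) : M.transOp π q ≤ M.maxOp q :=
  fun _ => PMF.expect_mono _ fun s' => PMF.expect_le _ fun a' =>
    Finset.le_sup' (fun a' => q ⟨s', a'⟩) (Finset.mem_univ a')

lemma exists_greedy (q : (Σ s, A s) → ℝ) :
    ∃ f : (s : S) → A s, M.transOp (Policy.det f) q = M.maxOp q := by
  choose f _ hf using fun s => Finset.exists_mem_eq_sup' (Finset.univ_nonempty (α := A s))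
    fun a => q ⟨s, a⟩
  refine ⟨f, ?_⟩
  ext x
  simp only [transOp_det_apply, maxOp, hf]

variable {M}

/-- There are finitely many deterministic policies, so the least of their individual ε works for
all. -/
lemma ImproperCost.exists_perturbation (h : M.ImproperCost g r) :
    ∃ ε : ℝ, 0 < ε ∧ M.ImproperCost g (r + ε • offPoint g) := by
  have hf : ∀ f : (s : S) → A s, ∃ ε : ℝ, 0 < ε ∧
      (¬ IsAbsorbedAt (M.transOp (Policy.det f)) g → ∀ δ : ℝ, 0 ≤ δ → δ ≤ ε → ∀ b : ℝ,
        ∃ n x, partialSum (M.transOp (Policy.det f)) (r + δ • offPoint g) n x < b) := by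
    intro f
    by_cases hf : IsAbsorbedAt (M.transOp (Policy.det f)) g
    · exact ⟨1, one_pos, fun h => absurd hf h⟩
    · obtain ⟨ε, hε, h'⟩ :=
        (M.isMarkov_transOp _).exists_perturbation (offPoint_le_one g) (h f hf)
      exact ⟨ε, hε, fun _ => h'⟩
  choose ε hε hεf using hf
  obtain ⟨f₀, hf₀⟩ := Finite.exists_min ε
  exact ⟨ε f₀, hε f₀, fun f hf => hεf f hf (ε f₀) (hε f₀).le (hf₀ f)⟩

/-- Policy improvement: the Bellman optimality equation has a solution. -/
lemma exists_bellman (hg : ∀ π f, M.transOp π f g = f g) (hr : r g = 0)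
    (h : M.ImproperCost g r) {π : Policy A} (hπ : IsAbsorbedAt (M.transOp π) g) :
    ∃ q : (Σ s, A s) → ℝ, q g = 0 ∧ q = r + M.maxOp q := by
  have himp : ∀ (π' : Policy A) (v : (Σ s, A s) → ℝ), v = r + M.transOp π' v →
      ∃ f, v ≤ r + M.transOp (Policy.det f) v ∧ M.transOp (Policy.det f) v = M.maxOp v ∧
        IsAbsorbedAt (M.transOp (Policy.det f)) g := fun π' v hv => by
    obtain ⟨f, hf⟩ := M.exists_greedy v
    have hle : v ≤ r + M.transOp (Policy.det f) v := by
      rw [hf]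
      exact hv.le.trans (add_le_add_right (M.transOp_le_maxOp π' v) r)
    exact ⟨f, hle, hf, h.isAbsorbedAt hle⟩
  choose! v hvg hv using fun (f : (s : S) → A s)
    (hf : IsAbsorbedAt (M.transOp (Policy.det f)) g) =>
    (M.isMarkov_transOp _).exists_poisson (hg _) hf hr
  obtain ⟨v₀, -, hv₀⟩ := (M.isMarkov_transOp π).exists_poisson (hg π) hπ hr
  -- The given proper policy may be randomised; its greedy improvement is a deterministic proper
  -- one.
  obtain ⟨f₀, -, -, hf₀⟩ := himp π v₀ hv₀
  -- Maximising the sum of the values turns a pointwise improvement into equality.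
  obtain ⟨f, hf, hmax⟩ := Set.exists_max_image
    {f : (s : S) → A s | IsAbsorbedAt (M.transOp (Policy.det f)) g} (fun f => ∑ x, v f x)
    (Set.toFinite _) ⟨f₀, hf₀⟩
  obtain ⟨f', hle, hgreedy, hf'⟩ := himp _ _ (hv f hf)
  have hvle : v f ≤ v f' :=
    (M.isMarkov_transOp _).le_of_le_add hf' (hvg f hf) (hvg f' hf') hle (hv f' hf')
  have heq : v f' = v f := by
    ext x
    exact ((Finset.sum_eq_sum_iff_of_le fun x _ => hvle x).1
      (le_antisymm (Finset.sum_le_sum fun x _ => hvle x) (hmax f' hf')) x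
      (Finset.mem_univ x)).symm
  refine ⟨v f, hvg f hf, ?_⟩
  have := hv f' hf'
  rwa [heq, hgreedy] at this

/-- The limit inferior of the partial sums under any policy is at most a solution of the Bellman
optimality equation, if the equation for some larger reward off the goal has a solution too. -/
lemma liminf_partialSum_le (hg : ∀ π f, M.transOp π f g = f g) {ε : ℝ} (hε : 0 < ε)
    {w q : (Σ s, A s) → ℝ} (hw : w = r + ε • offPoint g + M.maxOp w)
    (hqg : q g = 0) (hq : q = r + M.maxOp q) (π : Policy A) (x : Σ s, A s) :
    liminf (fun τ => ((partialSum (M.transOp π) r (τ + 1) x : ℝ) : EReal)) atTop ≤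
      (q x : EReal) := by
  have hP := M.isMarkov_transOp π
  have hwπ : r + ε • offPoint g + M.transOp π w ≤ w := by
    conv_rhs => rw [hw]
    exact add_le_add_right (M.transOp_le_maxOp π w) _
  have hqπ : r + M.transOp π q ≤ q := by
    conv_rhs => rw [hq]
    exact add_le_add_right (M.transOp_le_maxOp π q) _
  have hanti := hP.antitone_pow_offPoint (hg π) x
  have hnonneg : ∀ t, 0 ≤ (M.transOp π ^ t) (offPoint g) x :=
    fun t => (hP.pow t).map_nonneg (offPoint_nonneg g) x
  obtain ⟨c, hc⟩ : ∃ c, Tendsto (fun t => (M.transOp π ^ t) (offPoint g) x) atTop (𝓝 c) :=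
    ⟨_, tendsto_atTop_ciInf hanti ⟨0, by rintro _ ⟨t, rfl⟩; exact hnonneg t⟩⟩
  -- The limit c is the probability of never reaching g from x.
  rcases (ge_of_tendsto' hc hnonneg).eq_or_lt with rfl | hcpos
  · have hlim : Tendsto (fun τ => q x - (M.transOp π ^ (τ + 1)) q x) atTop (𝓝 (q x)) := by
      have := (hP.tendsto_pow_apply hqg hc).comp (tendsto_add_atTop_nat 1)
      simpa using this.const_sub (q x)
    have hlim' := (continuous_coe_real_ereal.tendsto _).comp hlim
    rw [← hlim'.liminf_eq]
    refine liminf_le_liminf (Eventually.of_forall fun τ => EReal.coe_le_coe_iff.2 ?_)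
    have := hP.partialSum_add_le hqπ (τ + 1) x
    rw [Pi.add_apply] at this
    linarith
  · have hbound : ∀ n : ℕ, partialSum (M.transOp π) r n x ≤ 2 * ‖w‖ - n * (ε * c) := fun n => by
      have h₁ := hP.partialSum_le_norm hwπ n x
      have h₂ : n * c ≤ partialSum (M.transOp π) (offPoint g) n x := by
        rw [partialSum, Finset.sum_apply]
        simpa using Finset.card_nsmul_le_sum (Finset.range n) _ c
          fun t _ => hanti.le_of_tendsto hc t
      rw [partialSum_add, partialSum_smul, Pi.add_apply, Pi.smul_apply, smul_eq_mul] at h₁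
      nlinarith
    have hbot : Tendsto (fun n => partialSum (M.transOp π) r n x) atTop atBot := by
      refine tendsto_atBot_mono hbound ?_
      exact tendsto_atBot_add_const_left _ _ (tendsto_neg_atTop_atBot.comp
        (tendsto_natCast_atTop_atTop.atTop_mul_const (mul_pos hε hcpos)))
    have hbot' := EReal.tendsto_coe_nhds_bot_iff.2 (hbot.comp (tendsto_add_atTop_nat 1))
    exact hbot'.liminf_eq.trans_le bot_le

/-- The optimal action value is any solution of the Bellman optimality equation. -/
lemma qstar_eq_of_bellman (hg : ∀ π f, M.transOp π f g = f g) {ε : ℝ} (hε : 0 < ε)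
    {w q : (Σ s, A s) → ℝ} (hw : w = M.meanReward + ε • offPoint g + M.maxOp w)
    (himp : M.ImproperCost g M.meanReward)
    (hqg : q g = 0) (hq : q = M.meanReward + M.maxOp q) (s : S) (a : A s) :
    M.Qstar s a = (q ⟨s, a⟩ : EReal) := by
  have hQ : ∀ π, M.Q π s a = liminf (fun τ =>
      ((partialSum (M.transOp π) M.meanReward (τ + 1) ⟨s, a⟩ : ℝ) : EReal)) atTop := fun π => by
    simp only [Q, totalReturn, partialReturn_startPair]
  refine le_antisymm (iSup_le fun π => ?_) ?_
  · rw [hQ]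
    exact liminf_partialSum_le hg hε hw hqg hq π ⟨s, a⟩
  · obtain ⟨f, hf⟩ := M.exists_greedy q
    rw [← hf] at hq
    have hP := M.isMarkov_transOp (Policy.det f)
    have habs := himp.isAbsorbedAt hq.le
    refine le_trans ?_ (le_iSup _ (Policy.det f))
    have hlim : Tendsto (fun τ => q ⟨s, a⟩ - (M.transOp (Policy.det f) ^ (τ + 1)) q ⟨s, a⟩) atTop
        (𝓝 (q ⟨s, a⟩)) := by
      have := (hP.tendsto_pow_apply hqg (habs ⟨s, a⟩)).comp (tendsto_add_atTop_nat 1)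
      simpa using this.const_sub (q ⟨s, a⟩)
    have hlim' := (continuous_coe_real_ereal.tendsto _).comp hlim
    rw [hQ, ← hlim'.liminf_eq]
    refine liminf_le_liminf (Eventually.of_forall fun τ => EReal.coe_le_coe_iff.2 ?_)
    have := hP.le_partialSum_add hq.le (τ + 1) ⟨s, a⟩
    rw [Pi.add_apply] at this
    linarith

end Optimality

end MDP

theorem mainTheorem1 {S : Type*} {A : S → Type*} [Fintype S] [∀ s, Fintype (A s)]
    [∀ s, Nonempty (A s)] (M : MDP S A) (sg : S) (ag : A sg)
    (hgoal : M.IsGoal sg ag) (hM : M.ProperAssumption sg) :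
    ∃ q : (s : S) → A s → ℝ,
      (∀ s a, M.Qstar s a = (q s a : EReal)) ∧
      q sg ag = 0 ∧
      M.BellmanOptimality q ∧
      ∀ q' : (s : S) → A s → ℝ, q' sg ag = 0 → M.BellmanOptimality q' → q' = q := by
  have hsg := hgoal.only_action
  have hg : ∀ π f, M.transOp π f ⟨sg, ag⟩ = f ⟨sg, ag⟩ := fun π f => by
    rw [MDP.transOp_apply, hgoal.absorbing.1, PMF.expect_pure]
    simp only [hsg, PMF.expect_const]
  have hr : M.meanReward ⟨sg, ag⟩ = 0 := by
    simp [MDP.meanReward, hgoal.absorbing.2]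
  have himp := hM.improperCost hsg
  obtain ⟨π, hπ⟩ := hM.exists_proper
  rw [M.isProper_iff π hsg] at hπ
  obtain ⟨ε, hε, himpε⟩ := himp.exists_perturbation
  -- The raised reward still vanishes at the goal.
  obtain ⟨w, -, hw⟩ := MDP.exists_bellman hg (by simp [hr]) himpε hπ
  obtain ⟨q, hqg, hq⟩ := MDP.exists_bellman hg hr himp hπ
  have hQ := MDP.qstar_eq_of_bellman hg hε hw himp hqg hq
  refine ⟨fun s a => q ⟨s, a⟩, hQ, hqg, fun s a => congrFun hq ⟨s, a⟩, fun q' hq'g hq' => ?_⟩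
  have hQ' := MDP.qstar_eq_of_bellman hg hε hw himp (q := fun x => q' x.1 x.2) hq'g
    (funext fun x => hq' x.1 x.2)
  ext s a
  exact EReal.coe_injective ((hQ' s a).symm.trans (hQ s a))
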